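/- **Definitions.** All Lie algebras are over $\mathbb C$. An *extended affine Lie algebra* is a triple $(E,(\cdot,\cdot),H)$, where $E$ is a complex Lie algebra, $H\neq 0$ is a finite-dimensional subalgebra and $(\cdot,\cdot)$ is a symmetric bilinear form on $E$, such that: (A1) the form is invariant and non-degenerate; (A2) $E=\sum_{\alpha\in R}E_\alpha$ and $E_0=H$, where $E_\alpha=\{x\in E: [h,x]=\alpha(h)x\ \text{for all } h\in H\}$ for $\alpha\in H^\star$, and $R=\{\alpha\in H^\star: E_\alpha\ne 0\}$ is the *root system*. The form is then non-degenerate on $H$ and is transferred to $H^\star$ by $(\alpha,\beta)=(t_\alpha,t_\beta)$, where $t_\alpha\in H$ is given by $\alpha(h)=(h,t_\alpha)$ for all $h\in H$. Put $R^0=\{\alpha\in R:(\alpha,\alpha)=0\}$ and $R^\times=R\setminus R^0$, and let the *core* $E_c$ be the subalgebra generated by all $E_\alpha$, $\alpha\in R^\times$; (A3) $\operatorname{ad}x$ is locally nilpotent on $E$ for $x\in E_\alpha$, $\alpha\in R^\times$; (A4) the centralizer of $E_c$ in $E$ is contained in $E_c$; (A5) the $\mathbb Z$-span $\langle R\rangle$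 of $R$ is a free abelian group of finite rank; (A6) $R^\times$ is not the disjoint union of two non-empty subsets orthogonal to each other. Let $V^0=\operatorname{span}_{\mathbb R}R^0$ and let $\bar R$ be the image of $R$ in $H^\star/V^0$. The *rank* of $R$ is $\dim_{\mathbb R}\operatorname{span}_{\mathbb R}\bar R$. $E$ is of *reduced type* if there is no $0\neq a\in\bar R$ with $2a\in\bar R$. For $\alpha\in R^\times$ let $w_\alpha(\beta)=\beta-\frac{2(\alpha,\beta)}{(\alpha,\alpha)}\alpha$; for $P\subseteq R^\times$ let $W_P$ be the group generated by the $w_\alpha$, $\alpha\in P$. A *reflectable base* is a subset $P\subseteq R^\times$ with $W_PP=R^\times$ such that no proper subset of $P$ has this property. Let $\operatorname{refl}(R)$ be the smallest cardinality of a (finite) reflectable base, and $\operatorname{ind}(R)=\operatorname{refl}(R)-\operatorname{rank}_{\mathbb Z}\langle R\rangle$. A *Cartan automorphism* is a Lie algebra automorphism $\Psi$ of $E$ with $\Psi(h)=h$ for all $h\in H$. A *Chevalley involution* is a Lie algebra automorphism $\tau$ of $E$ of finite order with $\tau(h)=-h$ for all $h\in H$. A *character* of $R$ is a map $\psi:R\to\mathbb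 C^\times$ with $\psi(\alpha+\beta)=\psi(\alpha)\psi(\beta)$ whenever $\alpha,\beta,\alpha+\beta\in R$; characters form a group $\chi$ under pointwise multiplication, with subgroup $\chi^{\rm fin}$ of elements of finite order. **Theorem.** Let $E$ be an extended affine Lie algebra of reduced type with root system $R$ such that $\operatorname{rank}R>1$ and $\operatorname{ind}(R)=0$. (i) The set $\mathcal C^{\rm fin}$ of finite-order Cartan automorphisms of $E$ is a subgroup of $\operatorname{Aut}(E)$, and $\mathcal C^{\rm fin}\cong\chi^{\rm fin}$. More precisely, there is a group isomorphism $\mathcal C^{\rm fin}\to\chi^{\rm fin}$, $\Psi\mapsto\psi$, such that $\Psi(x)=\psi(\alpha)x$ for all $\alpha\in R$ and $x\in E_\alpha$. (ii) If $\tau$ is a Chevalley involution of $E$ and $\Psi\in\mathcal C^{\rm fin}$, then $\tau\Psi$ is a Chevalley involution of $E$; in particular it has finite order. -/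

import Mathlib

/-- Lie algebra automorphisms form a group under composition, `(σ * τ) x = σ (τ x)`. -/
instance lieAutGroup {E : Type*} [LieRing E] [LieAlgebra ℂ E] : Group (E ≃ₗ⁅ℂ⁆ E) where
  mul σ τ := τ.trans σ
  one := 1
  inv σ := σ.symm
  mul_assoc _ _ _ := LieEquiv.ext fun _ => rfl
  one_mul _ := LieEquiv.ext fun _ => rfl
  mul_one _ := LieEquiv.ext fun _ => rfl
  inv_mul_cancel σ := LieEquiv.ext fun x => σ.symm_apply_apply x

theorem lieAut_mul_apply {E : Type*} [LieRing E] [LieAlgebra ℂ E] (σ τ : E ≃ₗ⁅ℂ⁆ E) (x : E) :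
    (σ * τ) x = σ (τ x) := rfl

/-- The simultaneous eigenspace `E_α = {x | [h, x] = α(h) x for all h ∈ H}`. -/
def eigenRootSpace {E : Type*} [LieRing E] [LieAlgebra ℂ E] (H : LieSubalgebra ℂ E)
    (α : Module.Dual ℂ H) : Submodule ℂ E where
  carrier := {x | ∀ h : H, ⁅(h : E), x⁆ = α h • x}
  add_mem' {x y} hx hy h := by rw [lie_add, hx h, hy h, smul_add]
  zero_mem' h := by simp
  smul_mem' c x hx h := by rw [lie_smul, hx h, smul_comm]

/-- A complex Lie algebra with an invariant non-degenerate symmetric bilinear form and a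
non-trivial finite-dimensional splitting Cartan subalgebra `H` with `E_0 = H`:
the first two of the axioms of an extended affine Lie algebra. -/
structure SplitQuadraticLieAlgebra (E : Type*) [LieRing E] [LieAlgebra ℂ E] where
  form : LinearMap.BilinForm ℂ E
  H : LieSubalgebra ℂ E
  finite_H : Module.Finite ℂ H
  H_ne_bot : H ≠ ⊥
  form_symm : form.IsSymm
  form_invariant : ∀ x y z : E, form ⁅x, y⁆ z = form x ⁅y, z⁆
  form_nondegenerate : form.Nondegenerate
  iSup_eigenRootSpace : ⨆ α : Module.Dual ℂ H, eigenRootSpace H α = ⊤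
  eigenRootSpace_zero : eigenRootSpace H 0 = H.toSubmodule

namespace SplitQuadraticLieAlgebra

variable {E : Type*} [LieRing E] [LieAlgebra ℂ E] (A : SplitQuadraticLieAlgebra E)

instance : Module.Finite ℂ A.H := A.finite_H

/-- The root space `E_α`. -/
def rootSpace (α : Module.Dual ℂ A.H) : Submodule ℂ E := eigenRootSpace A.H α

/-- The root system `R = {α ∈ H* | E_α ≠ 0}` (it contains `0`). -/
def roots : Set (Module.Dual ℂ A.H) := {α | A.rootSpace α ≠ ⊥}

/-- The restriction of the form to `H`. -/
noncomputable def formH : LinearMap.BilinForm ℂ A.H :=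
  A.form.compl₁₂ (A.H.incl : A.H →ₗ[ℂ] E) (A.H.incl : A.H →ₗ[ℂ] E)

theorem formH_apply (h k : A.H) : A.formH h k = A.form (h : E) (k : E) := rfl

theorem formH_nondegenerate : A.formH.Nondegenerate := by
  have lie_zero_of_H : ∀ h k : A.H, ⁅(h : E), (k : E)⁆ = 0 := by
    intro h k
    have hk : (k : E) ∈ eigenRootSpace A.H 0 := by
      rw [A.eigenRootSpace_zero]
      exact k.2
    simpa using hk h
  have key : ∀ h : A.H, (∀ k : A.H, A.form (h : E) (k : E) = 0) → h = 0 := by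
    intro h hh
    have hall : ∀ x : E, A.form (h : E) x = 0 := by
      intro x
      have hx : x ∈ ⨆ α : Module.Dual ℂ A.H, eigenRootSpace A.H α := by
        rw [A.iSup_eigenRootSpace]
        trivial
      induction hx using Submodule.iSup_induction' with
      | mem α x hx =>
        by_cases hα : α = 0
        · subst hα
          rw [A.eigenRootSpace_zero] at hx
          exact hh ⟨x, hx⟩
        · obtain ⟨k, hk⟩ : ∃ k, α k ≠ 0 := by
            by_contra! hc
            exact hα (LinearMap.ext hc)
          have h1 := A.form_invariant (h : E) (k : E) x
          rw [lie_zero_of_H, hx k] at h1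
          simp only [map_zero, LinearMap.zero_apply, map_smul, smul_eq_mul] at h1
          exact (mul_eq_zero.mp h1.symm).resolve_left hk
      | zero => simp
      | add x y _ _ hx hy => rw [map_add, hx, hy, add_zero]
    exact Subtype.ext (A.form_nondegenerate.1 _ hall)
  refine ⟨fun h hh => key h hh, fun h hh => key h fun k => ?_⟩
  rw [A.form_symm.eq]
  exact hh k

/-- The element `t_α ∈ H` determined by `α(h) = (t_α, h)` for all `h ∈ H`. -/
noncomputable def t (α : Module.Dual ℂ A.H) : A.H :=
  (LinearMap.BilinForm.toDual A.formH A.formH_nondegenerate).symm α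

theorem form_t (α : Module.Dual ℂ A.H) (h : A.H) : A.form (h : E) (A.t α : E) = α h := by
  rw [A.form_symm.eq]
  exact LinearMap.BilinForm.apply_toDual_symm_apply (hB := A.formH_nondegenerate) α h

/-- The form `(α, β) = (t_α, t_β)` on `H*`. -/
noncomputable def dualForm : LinearMap.BilinForm ℂ (Module.Dual ℂ A.H) :=
  A.formH.compl₁₂
    (LinearMap.BilinForm.toDual A.formH A.formH_nondegenerate).symm.toLinearMap
    (LinearMap.BilinForm.toDual A.formH A.formH_nondegenerate).symm.toLinearMap

theorem dualForm_apply (α β : Module.Dual ℂ A.H) :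
    A.dualForm α β = A.form (A.t α : E) (A.t β : E) := rfl

/-- The isotropic roots `R⁰`. -/
def isotropicRoots : Set (Module.Dual ℂ A.H) := {α ∈ A.roots | A.dualForm α α = 0}

/-- The non-isotropic roots `R^×`. -/
def nonisotropicRoots : Set (Module.Dual ℂ A.H) := {α ∈ A.roots | A.dualForm α α ≠ 0}

/-- The core `E_c`: the subalgebra generated by the non-isotropic root spaces. -/
def core : LieSubalgebra ℂ E :=
  LieSubalgebra.lieSpan ℂ E {x | ∃ α ∈ A.nonisotropicRoots, x ∈ A.rootSpace α}

/-- The root lattice `⟨R⟩`, the `ℤ`-span of the roots in `H*`. -/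
def rootLattice : Submodule ℤ (Module.Dual ℂ A.H) := Submodule.span ℤ A.roots

/-- The reflection `w_α(β) = β - (2(α, β)/(α, α)) α`, for `(α, α) ≠ 0`. -/
noncomputable def reflection (α : Module.Dual ℂ A.H) (hα : A.dualForm α α ≠ 0) :
    Module.Dual ℂ A.H ≃ₗ[ℂ] Module.Dual ℂ A.H :=
  Module.reflection (x := α) (f := (2 / A.dualForm α α) • A.dualForm α)
    (by rw [LinearMap.smul_apply, smul_eq_mul, div_mul_cancel₀ _ hα])

theorem reflection_apply (α : Module.Dual ℂ A.H) (hα : A.dualForm α α ≠ 0)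
    (β : Module.Dual ℂ A.H) :
    A.reflection α hα β = β - (2 * A.dualForm α β / A.dualForm α α) • α := by
  rw [reflection, Module.reflection_apply, LinearMap.smul_apply, smul_eq_mul]
  congr 2
  ring

/-- The group `W_P` generated by the reflections `w_α`, `α ∈ P` (for `P ⊆ R^×`). -/
def reflectionGroup (P : Set (Module.Dual ℂ A.H)) :
    Subgroup (Module.Dual ℂ A.H ≃ₗ[ℂ] Module.Dual ℂ A.H) :=
  Subgroup.closure {w | ∃ (α : Module.Dual ℂ A.H) (hα : A.dualForm α α ≠ 0),
    α ∈ P ∧ w = A.reflection α hα}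

/-- The set `W_P P`. -/
def reflectionOrbit (P : Set (Module.Dual ℂ A.H)) : Set (Module.Dual ℂ A.H) :=
  {γ | ∃ w ∈ A.reflectionGroup P, ∃ β ∈ P, γ = w β}

/-- A reflectable base: a subset `P ⊆ R^×`, minimal with the property `W_P P = R^×`. -/
def IsReflectableBase (P : Set (Module.Dual ℂ A.H)) : Prop :=
  P ⊆ A.nonisotropicRoots ∧ A.reflectionOrbit P = A.nonisotropicRoots ∧
    ∀ Q, Q ⊂ P → A.reflectionOrbit Q ≠ A.nonisotropicRoots

/-- `refl(R)`, the smallest cardinality of a reflectable base. -/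
noncomputable def refl : ℕ :=
  sInf {n | ∃ P, A.IsReflectableBase P ∧ P.Finite ∧ P.ncard = n}

/-- The index `ind(R) = refl(R) - rank ⟨R⟩`. -/
noncomputable def ind : ℤ := (A.refl : ℤ) - (Module.finrank ℤ A.rootLattice : ℤ)

/-- `V⁰`, the real span of the isotropic roots. -/
noncomputable def V0 : Submodule ℝ (Module.Dual ℂ A.H) := Submodule.span ℝ A.isotropicRoots

/-- `R̄`, the image of `R` modulo `V⁰`. -/
noncomputable def rootsBar : Set (Module.Dual ℂ A.H ⧸ A.V0) := A.V0.mkQ '' A.roots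

/-- The rank of `R`: the dimension of the real span of the finite root system `R̄`, that is,
of `span_ℝ(R)/V⁰`. -/
noncomputable def rank : ℕ := Module.finrank ℝ (Submodule.span ℝ A.rootsBar)

/-- Reduced type: the finite root system `R̄` is reduced, i.e. twice a non-zero element of `R̄`
is not in `R̄`. -/
def IsReduced : Prop := ∀ a ∈ A.rootsBar, a ≠ 0 → (2 : ℝ) • a ∉ A.rootsBar

/-- The group of Cartan automorphisms: automorphisms fixing `H` pointwise. -/
def cartanAut : Subgroup (E ≃ₗ⁅ℂ⁆ E) where
  carrier := {σ | ∀ h ∈ A.H, σ h = h}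
  mul_mem' {σ τ} hσ hτ h hh := by rw [lieAut_mul_apply, hτ h hh, hσ h hh]
  one_mem' _ _ := rfl
  inv_mem' {σ} hσ h hh := by
    have h1 : σ.symm (σ h) = h := σ.symm_apply_apply h
    rw [hσ h hh] at h1
    exact h1

/-- The Chevalley involutions: automorphisms of finite order acting as `-1` on `H`. -/
def chevalleyInvolutions : Set (E ≃ₗ⁅ℂ⁆ E) :=
  {τ | IsOfFinOrder τ ∧ ∀ h ∈ A.H, τ h = -h}

/-- The group of characters of `R` under pointwise multiplication: maps `ψ : R → ℂ^×` with
`ψ(α + β) = ψ(α) ψ(β)` whenever `α, β, α + β ∈ R`. -/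
def characterGroup : Subgroup (A.roots → ℂˣ) where
  carrier := {ψ | ∀ α β γ : A.roots,
    (γ : Module.Dual ℂ A.H) = (α : Module.Dual ℂ A.H) + (β : Module.Dual ℂ A.H) →
      ψ γ = ψ α * ψ β}
  mul_mem' {φ ψ} hφ hψ α β γ h := by
    rw [Pi.mul_apply, Pi.mul_apply, Pi.mul_apply, hφ α β γ h, hψ α β γ h, mul_mul_mul_comm]
  one_mem' _ _ _ _ := by simp
  inv_mem' {φ} hφ α β γ h := by
    rw [Pi.inv_apply, Pi.inv_apply, Pi.inv_apply, hφ α β γ h, mul_inv]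

end SplitQuadraticLieAlgebra

/-- An extended affine Lie algebra `(E, (·,·), H)`, tameness included. -/
structure ExtendedAffineLieAlgebra (E : Type*) [LieRing E] [LieAlgebra ℂ E] extends
    SplitQuadraticLieAlgebra E where
  ad_locally_nilpotent : ∀ α ∈ toSplitQuadraticLieAlgebra.nonisotropicRoots,
    ∀ x ∈ toSplitQuadraticLieAlgebra.rootSpace α, ∀ y : E, ∃ n : ℕ,
      ((LieAlgebra.ad ℂ E x) ^ n) y = 0
  tame : ∀ x : E, (∀ y ∈ toSplitQuadraticLieAlgebra.core, ⁅x, y⁆ = 0) →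
    x ∈ toSplitQuadraticLieAlgebra.core
  rootLattice_free : Module.Free ℤ toSplitQuadraticLieAlgebra.rootLattice
  rootLattice_finite : Module.Finite ℤ toSplitQuadraticLieAlgebra.rootLattice
  indecomposable : ∀ R₁ R₂ : Set (Module.Dual ℂ H), R₁.Nonempty → R₂.Nonempty →
    Disjoint R₁ R₂ → R₁ ∪ R₂ = toSplitQuadraticLieAlgebra.nonisotropicRoots →
      ∃ α ∈ R₁, ∃ β ∈ R₂, toSplitQuadraticLieAlgebra.dualForm α β ≠ 0

/-! A character `ψ` of the roots defines the diagonal automorphism that scales `E_α` by `ψ α`. This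
embeds the character group into the Cartan automorphisms, so the real content is that every Cartan
automorphism `Ψ` of finite order is diagonal (`exists_diagonalAut_eq`).

Local nilpotency and `sl₂`-theory make the non-isotropic root spaces lines, so `Ψ` acts on `E_α` by
a scalar `c(α)`. Moving vectors along root strings gives `c(w_α β) = c(β) c(α)⁻ᵈ`, where `d` is the
Cartan integer. A reflectable base `P` spans the root lattice: reflections change a root by integer
multiples of elements of `P`, and tameness puts the isotropic roots in the span of the others. Index
zero says that `P` has as many elements as the rank of the lattice, so `P` is a `ℤ`-basis and `c` on
`P` extends to a homomorphism `φ`. By induction along reflections, `φ` agrees with `c` on all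
non-isotropic roots.

Dividing `Ψ` by the diagonal automorphism of `φ` leaves an automorphism `Φ` of finite order fixing
the core pointwise. On an isotropic root vector `x`, the difference `z = Φ x - x` centralizes the
core, hence lies in it by tameness and is fixed by `Φ`. So `Φⁿ x = x + n z`, and finite order forces
`z = 0`.

An automorphism `τ` acting as `-1` on `H` satisfies `D τ D = τ` for diagonal `D`, whence `(τ D)² =
τ²`; this gives (ii). -/

namespace SplitQuadraticLieAlgebra

open Module

variable {E : Type*} [LieRing E] [LieAlgebra ℂ E] (A : SplitQuadraticLieAlgebra E)

/-! ### Root spaces and the invariant form -/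

section RootSpaces

variable {A}

theorem mem_rootSpace_zero {x : E} : x ∈ A.rootSpace 0 ↔ x ∈ A.H := by
  rw [rootSpace, A.eigenRootSpace_zero, LieSubalgebra.mem_toSubmodule]

theorem lie_H_H (h k : A.H) : ⁅(h : E), (k : E)⁆ = 0 := by
  have hk : (k : E) ∈ A.rootSpace 0 := mem_rootSpace_zero.2 k.2
  simpa using hk h

theorem lie_mem_rootSpace {α β : Dual ℂ A.H} {x y : E} (hx : x ∈ A.rootSpace α)
    (hy : y ∈ A.rootSpace β) : ⁅x, y⁆ ∈ A.rootSpace (α + β) := fun h => by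
  rw [leibniz_lie, hx h, hy h, smul_lie, lie_smul, LinearMap.add_apply, add_smul]

theorem rootSpace_induction {p : E → Prop}
    (mem : ∀ (α : Dual ℂ A.H) (x : E), x ∈ A.rootSpace α → p x) (zero : p 0)
    (add : ∀ x y, p x → p y → p (x + y)) (x : E) : p x := by
  have hx : x ∈ ⨆ α : Dual ℂ A.H, A.rootSpace α := by
    have := A.iSup_eigenRootSpace
    rw [show (⨆ α : Dual ℂ A.H, A.rootSpace α) = ⊤ from this]
    trivial
  exact Submodule.iSup_induction _ (motive := p) hx mem zero add

theorem mem_roots_of_ne_zero {α : Dual ℂ A.H} {x : E} (hx : x ∈ A.rootSpace α) (h0 : x ≠ 0) :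
    α ∈ A.roots := fun h => h0 ((Submodule.mem_bot ℂ).1 (h ▸ hx))

theorem exists_ne_zero_of_mem_roots {α : Dual ℂ A.H} (hα : α ∈ A.roots) :
    ∃ x ∈ A.rootSpace α, x ≠ 0 :=
  Submodule.exists_mem_ne_zero_of_ne_bot hα

theorem zero_mem_roots : (0 : Dual ℂ A.H) ∈ A.roots := by
  intro h
  apply A.H_ne_bot
  rw [rootSpace, A.eigenRootSpace_zero] at h
  exact (LieSubalgebra.toSubmodule_eq_bot _).1 h

-- `H` is abelian, so its root spaces lie in generalized weight spaces, which are independent.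
variable (A) in
theorem iSupIndep_rootSpace : iSupIndep A.rootSpace := by
  have : IsLieAbelian A.H := ⟨fun h k => Subtype.ext (lie_H_H h k)⟩
  have h1 := LieModule.iSupIndep_genWeightSpace ℂ A.H E
  rw [← LieSubmodule.iSupIndep_toSubmodule] at h1
  have h2 := h1.comp (f := fun α : Dual ℂ A.H => (α : A.H → ℂ)) DFunLike.coe_injective
  refine h2.mono fun α x hx => ?_
  exact LieModule.weightSpace_le_genWeightSpace E _
    ((LieModule.mem_weightSpace _ x).2 fun h => hx h)

theorem form_eq_zero {α β : Dual ℂ A.H} (h : α + β ≠ 0) {x y : E} (hx : x ∈ A.rootSpace α)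
    (hy : y ∈ A.rootSpace β) : A.form x y = 0 := by
  obtain ⟨k, hk⟩ : ∃ k, (α + β) k ≠ 0 := by
    by_contra! hc
    exact h (LinearMap.ext hc)
  have h1 := A.form_invariant x (k : E) y
  rw [← lie_skew, hx k, hy k] at h1
  simp only [map_neg, LinearMap.neg_apply, map_smul, LinearMap.smul_apply, smul_eq_mul] at h1
  have h2 : (α + β) k * A.form x y = 0 := by
    rw [LinearMap.add_apply, add_mul, ← h1]; ring
  exact (mul_eq_zero.1 h2).resolve_left hk

/-- `E_α` is orthogonal to every `E_β` with `β ≠ -α`, so non-degeneracy must already be visible on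
`E_{-α}`. -/
theorem exists_form_ne_zero {α : Dual ℂ A.H} {x : E} (hx : x ∈ A.rootSpace α) (h0 : x ≠ 0) :
    ∃ y ∈ A.rootSpace (-α), A.form x y ≠ 0 := by
  by_contra! hc
  refine h0 (A.form_nondegenerate.1 x fun y => ?_)
  induction y using rootSpace_induction (A := A) with
  | mem β y hy =>
    by_cases h : α + β = 0
    · rw [← neg_eq_of_add_eq_zero_right h] at hy
      exact hc y hy
    · exact form_eq_zero h hx hy
  | zero => simp
  | add y z hy hz => rw [map_add, hy, hz, add_zero]

theorem neg_mem_roots {α : Dual ℂ A.H} (hα : α ∈ A.roots) : -α ∈ A.roots := by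
  obtain ⟨x, hx, h0⟩ := exists_ne_zero_of_mem_roots hα
  obtain ⟨y, hy, h1⟩ := exists_form_ne_zero hx h0
  exact mem_roots_of_ne_zero hy (by rintro rfl; simp at h1)

/-- By invariance, both sides are elements of `H` with the same pairing against every element of
`H`, where the form is non-degenerate. -/
theorem lie_eq_form_smul_t {α : Dual ℂ A.H} {x y : E} (hx : x ∈ A.rootSpace α)
    (hy : y ∈ A.rootSpace (-α)) : ⁅x, y⁆ = A.form x y • (A.t α : E) := by
  have hH : ⁅x, y⁆ ∈ A.H := by
    rw [← mem_rootSpace_zero, ← add_neg_cancel α]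
    exact lie_mem_rootSpace hx hy
  suffices h : (⟨⁅x, y⁆, hH⟩ : A.H) - A.form x y • A.t α = 0 from
    congrArg Subtype.val (sub_eq_zero.1 h)
  refine A.formH_nondegenerate.1 _ fun k => ?_
  have h1 : A.form ⁅x, y⁆ k = α k * A.form x y := by
    rw [A.form_invariant, ← lie_skew, hy k]
    simp
  have h2 : A.form (A.t α : E) k = α k := by
    rw [A.form_symm.eq, A.form_t]
  rw [map_sub, LinearMap.sub_apply, map_smul, LinearMap.smul_apply, formH_apply, formH_apply]
  rw [h2]
  change A.form ⁅x, y⁆ k - _ = 0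
  rw [h1, smul_eq_mul]
  ring

theorem apply_t (α β : Dual ℂ A.H) : β (A.t α) = A.dualForm α β := by
  rw [dualForm_apply, form_t]

theorem dualForm_comm (α β : Dual ℂ A.H) : A.dualForm α β = A.dualForm β α := by
  rw [dualForm_apply, dualForm_apply, A.form_symm.eq]

end RootSpaces

/-! ### Diagonal automorphisms attached to characters -/

section Scale

variable {A}

theorem linearMap_ext_rootSpace {M : Type*} [AddCommGroup M] [Module ℂ M] {f g : E →ₗ[ℂ] M}
    (h : ∀ α, ∀ x ∈ A.rootSpace α, f x = g x) : f = g := by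
  ext x
  induction x using rootSpace_induction (A := A) with
  | mem α x hx => exact h α x hx
  | zero => simp
  | add x y hx hy => rw [map_add, map_add, hx, hy]

variable (A)

theorem exists_linearMap_scale (c : Dual ℂ A.H → ℂ) :
    ∃ f : E →ₗ[ℂ] E, ∀ α, ∀ x ∈ A.rootSpace α, f x = c α • x := by
  classical
  have hint : DirectSum.IsInternal A.rootSpace :=
    DirectSum.isInternal_submodule_of_iSupIndep_of_iSup_eq_top A.iSupIndep_rootSpace
      A.iSup_eigenRootSpace
  let e := LinearEquiv.ofBijective (DirectSum.coeLinearMap A.rootSpace) hint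
  refine ⟨(DirectSum.toModule ℂ _ E fun α => c α • (A.rootSpace α).subtype) ∘ₗ e.symm.toLinearMap,
    fun α x hx => ?_⟩
  have h1 : e.symm x = DirectSum.lof ℂ _ (fun α => A.rootSpace α) α ⟨x, hx⟩ := by
    rw [LinearEquiv.symm_apply_eq]
    exact (DirectSum.coeLinearMap_lof A.rootSpace α ⟨x, hx⟩).symm
  rw [LinearMap.comp_apply, LinearEquiv.coe_coe, h1, DirectSum.toModule_lof]
  rfl

/-- The linear endomorphism acting on the root space `E_α` as multiplication by `c α`. -/
noncomputable def scale (c : Dual ℂ A.H → ℂ) : E →ₗ[ℂ] E :=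
  (A.exists_linearMap_scale c).choose

variable {A} in
theorem scale_apply (c : Dual ℂ A.H → ℂ) {α : Dual ℂ A.H} {x : E} (hx : x ∈ A.rootSpace α) :
    A.scale c x = c α • x :=
  (A.exists_linearMap_scale c).choose_spec α x hx

open Classical in
/-- Extension of a map on the roots by `1` to all of `H*`. -/
noncomputable def extendByOne (ψ : A.roots → ℂˣ) (α : Dual ℂ A.H) : ℂ :=
  if h : α ∈ A.roots then (ψ ⟨α, h⟩ : ℂ) else 1

variable {A} in
theorem extendByOne_apply (ψ : A.roots → ℂˣ) (α : A.roots) : A.extendByOne ψ α = ψ α := by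
  simp [extendByOne]

theorem extendByOne_mul (φ ψ : A.roots → ℂˣ) (α : Dual ℂ A.H) :
    A.extendByOne (φ * ψ) α = A.extendByOne φ α * A.extendByOne ψ α := by
  unfold extendByOne
  split_ifs <;> simp

theorem extendByOne_one (α : Dual ℂ A.H) : A.extendByOne 1 α = 1 := by
  unfold extendByOne
  split_ifs <;> simp

theorem scale_extendByOne_mul_apply (φ ψ : A.roots → ℂˣ) (x : E) :
    A.scale (A.extendByOne (φ * ψ)) x =
      A.scale (A.extendByOne φ) (A.scale (A.extendByOne ψ) x) := by
  refine LinearMap.congr_fun (g := A.scale (A.extendByOne φ) ∘ₗ A.scale (A.extendByOne ψ))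
    (linearMap_ext_rootSpace (A := A) fun α x hx => ?_) x
  rw [LinearMap.comp_apply, scale_apply _ hx, scale_apply _ hx, map_smul, scale_apply _ hx,
    smul_smul, extendByOne_mul, mul_comm]

theorem scale_extendByOne_one_apply (x : E) : A.scale (A.extendByOne 1) x = x := by
  refine LinearMap.congr_fun (g := LinearMap.id)
    (linearMap_ext_rootSpace (A := A) fun α x hx => ?_) x
  rw [scale_apply _ hx, extendByOne_one, one_smul, LinearMap.id_apply]

theorem scale_extendByOne_lie (ψ : A.characterGroup) (x y : E) :
    A.scale (A.extendByOne ψ) ⁅x, y⁆ =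
      ⁅A.scale (A.extendByOne ψ) x, A.scale (A.extendByOne ψ) y⁆ := by
  induction x using rootSpace_induction (A := A) with
  | mem α x hx =>
    induction y using rootSpace_induction (A := A) with
    | mem β y hy =>
      have hxy := lie_mem_rootSpace hx hy
      rw [scale_apply _ hx, scale_apply _ hy, scale_apply _ hxy, smul_lie, lie_smul, smul_smul]
      -- Multiplicativity of `ψ` is available only when `α + β` is a root; otherwise the bracket
      -- vanishes.
      by_cases h0 : ⁅x, y⁆ = 0
      · simp [h0]
      have hα := mem_roots_of_ne_zero hx (by rintro rfl; simp at h0)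
      have hβ := mem_roots_of_ne_zero hy (by rintro rfl; simp at h0)
      have hαβ := mem_roots_of_ne_zero hxy h0
      have h1 := ψ.2 ⟨α, hα⟩ ⟨β, hβ⟩ ⟨α + β, hαβ⟩ rfl
      have h2 : A.extendByOne ψ (α + β) = A.extendByOne ψ α * A.extendByOne ψ β := by
        simpa only [extendByOne, dif_pos hα, dif_pos hβ, dif_pos hαβ, ← Units.val_mul,
          Units.val_inj] using h1
      rw [h2]
    | zero => simp
    | add y z hy hz => simp only [lie_add, map_add, hy, hz]
  | zero => simp
  | add x z hx hz => simp only [add_lie, map_add, hx, hz]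

/-- The diagonal automorphism attached to a character of the root system. -/
noncomputable def diagonalAut : A.characterGroup →* (E ≃ₗ⁅ℂ⁆ E) where
  toFun ψ :=
    { A.scale (A.extendByOne ψ) with
      map_lie' := A.scale_extendByOne_lie ψ _ _
      invFun := A.scale (A.extendByOne (ψ : A.roots → ℂˣ)⁻¹)
      left_inv := fun x => by
        change A.scale _ (A.scale _ x) = x
        rw [← scale_extendByOne_mul_apply, inv_mul_cancel, scale_extendByOne_one_apply]
      right_inv := fun x => by
        change A.scale _ (A.scale _ x) = x
        rw [← scale_extendByOne_mul_apply, mul_inv_cancel, scale_extendByOne_one_apply] }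
  map_one' := LieEquiv.ext fun x => A.scale_extendByOne_one_apply x
  map_mul' φ ψ := LieEquiv.ext fun x => A.scale_extendByOne_mul_apply φ ψ x

variable {A}

theorem diagonalAut_apply (ψ : A.characterGroup) (α : A.roots) {x : E}
    (hx : x ∈ A.rootSpace α) : A.diagonalAut ψ x = ((ψ : A.roots → ℂˣ) α : ℂ) • x := by
  rw [← extendByOne_apply]
  exact scale_apply _ hx

theorem diagonalAut_injective : Function.Injective A.diagonalAut := by
  intro φ ψ h
  refine Subtype.ext (funext fun α => Units.ext ?_)
  obtain ⟨x, hx, h0⟩ := exists_ne_zero_of_mem_roots α.2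
  have h1 := diagonalAut_apply φ α hx
  rw [h, diagonalAut_apply ψ α hx] at h1
  exact (smul_left_injective ℂ h0 h1).symm

theorem character_apply_zero (ψ : A.characterGroup) :
    (ψ : A.roots → ℂˣ) ⟨0, zero_mem_roots⟩ = 1 := by
  have h := ψ.2 ⟨0, zero_mem_roots⟩ ⟨0, zero_mem_roots⟩ ⟨0, zero_mem_roots⟩ (by simp)
  exact right_eq_mul.1 h

theorem diagonalAut_mem_cartanAut (ψ : A.characterGroup) : A.diagonalAut ψ ∈ A.cartanAut := by
  intro h hh
  rw [diagonalAut_apply ψ ⟨0, zero_mem_roots⟩ (mem_rootSpace_zero.2 hh), character_apply_zero]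
  simp

theorem cartanAut_apply_mem_rootSpace {Ψ : E ≃ₗ⁅ℂ⁆ E} (hΨ : Ψ ∈ A.cartanAut) {α : Dual ℂ A.H}
    {x : E} (hx : x ∈ A.rootSpace α) : Ψ x ∈ A.rootSpace α := fun h => by
  have h1 : Ψ (h : E) = h := hΨ h h.2
  calc ⁅(h : E), Ψ x⁆ = ⁅Ψ (h : E), Ψ x⁆ := by rw [h1]
    _ = Ψ ⁅(h : E), x⁆ := (LieEquiv.map_lie Ψ _ _).symm
    _ = α h • Ψ x := by rw [hx h, map_smul]

theorem lieAut_ext_rootSpace {σ τ : E ≃ₗ⁅ℂ⁆ E} (h : ∀ α, ∀ x ∈ A.rootSpace α, σ x = τ x) :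
    σ = τ := by
  have h1 := linearMap_ext_rootSpace (A := A) (f := (σ : E →ₗ[ℂ] E)) (g := (τ : E →ₗ[ℂ] E)) h
  exact LieEquiv.ext fun x => LinearMap.congr_fun h1 x

/-- A Cartan automorphism preserves each root space, on which the diagonal automorphism is a scalar.
Commutation keeps the quotient of two such automorphisms of finite order. -/
theorem commute_diagonalAut (ψ : A.characterGroup) {Ψ : E ≃ₗ⁅ℂ⁆ E} (hΨ : Ψ ∈ A.cartanAut) :
    Commute (A.diagonalAut ψ) Ψ := by
  refine lieAut_ext_rootSpace (A := A) fun α x hx => ?_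
  rw [lieAut_mul_apply, lieAut_mul_apply]
  by_cases hα : α ∈ A.roots
  · rw [diagonalAut_apply ψ ⟨α, hα⟩ hx,
      diagonalAut_apply ψ ⟨α, hα⟩ (cartanAut_apply_mem_rootSpace hΨ hx), map_smul]
  · have : x = 0 := by
      by_contra h0
      exact hα (mem_roots_of_ne_zero hx h0)
    simp [this]

end Scale

end SplitQuadraticLieAlgebra

/-! ### `sl₂`-modules with locally nilpotent action -/

namespace IsSl2Triple

variable {L M : Type*} [LieRing L] [LieAlgebra ℂ L] [AddCommGroup M] [Module ℂ M]
  [LieRingModule L M] [LieModule ℂ L M] {h e f : L}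

open LieModule

theorem lie_h_e_pow (t : IsSl2Triple h e f) {m : M} {μ : ℂ} (hm : ⁅h, m⁆ = μ • m) (n : ℕ) :
    ⁅h, (toEnd ℂ L M e ^ n) m⁆ = (μ + 2 * n) • (toEnd ℂ L M e ^ n) m := by
  induction n with
  | zero => simpa using hm
  | succ n ih =>
    rw [pow_succ', Module.End.mul_apply, toEnd_apply_apply, leibniz_lie, ih, t.lie_h_e_smul ℂ,
      smul_lie, lie_smul, ← add_smul]
    congr 1
    push_cast
    ring

/-- For a primitive vector `m` of weight `N`, the vectors `f ^ j m` with `j ≤ N` are non-zero. -/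
theorem HasPrimitiveVectorWith.f_pow_ne_zero {t : IsSl2Triple h e f} {m : M} {μ : ℂ}
    (P : HasPrimitiveVectorWith t m μ) {j : ℕ} (hj : ∀ i < j, μ ≠ i) :
    (toEnd ℂ L M f ^ j) m ≠ 0 := by
  induction j with
  | zero => simpa using P.ne_zero
  | succ j ih =>
    intro h0
    have h1 := P.lie_e_pow_succ_toEnd_f j
    rw [h0, lie_zero] at h1
    have h2 := ih fun i hi => hj i (by omega)
    refine (smul_ne_zero (mul_ne_zero ?_ (sub_ne_zero.2 (hj j (by omega)))) h2) h1.symm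
    exact_mod_cast Nat.succ_ne_zero j

theorem HasPrimitiveVectorWith.exists_eq_natCast {t : IsSl2Triple h e f} {m : M} {μ : ℂ}
    (P : HasPrimitiveVectorWith t m μ) (hf : ∃ n, (toEnd ℂ L M f ^ n) m = 0) :
    ∃ N : ℕ, μ = N := by
  by_contra! hc
  obtain ⟨n, hn⟩ := hf
  exact P.f_pow_ne_zero (fun i _ => hc i) hn

/-- The last non-zero vector among the `e ^ k m` is killed by `e`. -/
theorem exists_pow_hasPrimitiveVectorWith (t : IsSl2Triple h e f) {m : M} {μ : ℂ} (h0 : m ≠ 0)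
    (hm : ⁅h, m⁆ = μ • m) (he : ∃ n, (toEnd ℂ L M e ^ n) m = 0) :
    ∃ k : ℕ, t.HasPrimitiveVectorWith ((toEnd ℂ L M e ^ k) m) (μ + 2 * k) := by
  classical
  have hpos : Nat.find he ≠ 0 := fun hz => h0 (by simpa [hz] using Nat.find_spec he)
  obtain ⟨k, hk⟩ := Nat.exists_eq_succ_of_ne_zero hpos
  refine ⟨k, Nat.find_min he (by omega), t.lie_h_e_pow hm k, ?_⟩
  have := Nat.find_spec he
  rwa [hk, pow_succ', Module.End.mul_apply] at this

/-- When `e` and `f` act locally nilpotently, the weights of `h` are integers, and a vector of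
weight `d` can be moved to weight `-d` without being annihilated. -/
theorem exists_int_weight (t : IsSl2Triple h e f) {m : M} {μ : ℂ} (h0 : m ≠ 0)
    (hm : ⁅h, m⁆ = μ • m) (he : ∃ n, (toEnd ℂ L M e ^ n) m = 0)
    (hf : ∀ m' : M, ∃ n, (toEnd ℂ L M f ^ n) m' = 0) :
    ∃ d : ℤ, μ = d ∧ (0 ≤ d → ∃ j k : ℕ, (j : ℤ) - k = d ∧
      (toEnd ℂ L M f ^ j) ((toEnd ℂ L M e ^ k) m) ≠ 0) := by
  obtain ⟨k, P⟩ := t.exists_pow_hasPrimitiveVectorWith h0 hm he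
  obtain ⟨N, hN⟩ := P.exists_eq_natCast (hf _)
  -- The primitive vector `e ^ k m` has weight `N = d + 2k`. Applying `f` to it `N - k` times leads
  -- to weight `N - 2(N - k) = -d`; for `d ≥ 0` the natural subtraction is exact.
  refine ⟨N - 2 * k, by push_cast; rw [← hN]; ring, fun hd => ⟨N - k, k, by omega, ?_⟩⟩
  refine P.f_pow_ne_zero fun i hi => ?_
  rw [hN]
  exact_mod_cast (by omega : N ≠ i)

end IsSl2Triple

/-! ### Coroots, `sl₂`-triples and strings of isotropic roots -/

namespace SplitQuadraticLieAlgebra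

open Module

variable {E : Type*} [LieRing E] [LieAlgebra ℂ E] {A : SplitQuadraticLieAlgebra E}

/-- The coroot `2 t_α / (α, α)`. -/
noncomputable def coroot (A : SplitQuadraticLieAlgebra E) (α : Dual ℂ A.H) : A.H :=
  (2 / A.dualForm α α) • A.t α

theorem apply_coroot (α β : Dual ℂ A.H) :
    β (A.coroot α) = 2 * A.dualForm α β / A.dualForm α α := by
  rw [coroot, map_smul, apply_t, smul_eq_mul, div_mul_eq_mul_div]

theorem exists_isSl2Triple {α : Dual ℂ A.H} (hα : α ∈ A.nonisotropicRoots) {e : E}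
    (he : e ∈ A.rootSpace α) (h0 : e ≠ 0) :
    ∃ f ∈ A.rootSpace (-α), IsSl2Triple (A.coroot α : E) e f := by
  have hne := hα.2
  obtain ⟨y, hy, hey⟩ := exists_form_ne_zero he h0
  have h2 : α (A.coroot α) = 2 := by rw [apply_coroot, mul_div_assoc, div_self hne, mul_one]
  -- Since `[e, y] = (e, y) t_α`, this factor makes the bracket equal to the coroot.
  have hf : (2 / A.dualForm α α / A.form e y) • y ∈ A.rootSpace (-α) :=
    Submodule.smul_mem _ _ hy
  refine ⟨_, hf, ?_, ?_, ?_, ?_⟩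
  · intro h
    have h' : A.coroot α = 0 := Subtype.ext h
    rw [h', map_zero] at h2
    exact two_ne_zero h2.symm
  · rw [lie_smul, lie_eq_form_smul_t he hy, smul_smul, div_mul_cancel₀ _ hey, coroot]
    rfl
  · rw [he, h2, two_smul, two_nsmul]
  · rw [hf, LinearMap.neg_apply, h2, neg_smul, two_smul, two_nsmul]

theorem toEnd_pow_mem_rootSpace {α β : Dual ℂ A.H} {e x : E} (he : e ∈ A.rootSpace α)
    (hx : x ∈ A.rootSpace β) (n : ℕ) :
    (LieModule.toEnd ℂ E E e ^ n) x ∈ A.rootSpace (β + (n : ℂ) • α) := by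
  induction n with
  | zero => simpa using hx
  | succ n ih =>
    rw [pow_succ', Module.End.mul_apply, LieModule.toEnd_apply_apply]
    have := lie_mem_rootSpace he ih
    rwa [Nat.cast_succ, add_smul, one_smul, ← add_assoc, add_comm _ α]

/-- Infinitely many roots occur in a string `α + ℤ δ` with `(δ, δ) = 0 ≠ (δ, α)`. -/
theorem exists_root_string {α δ : Dual ℂ A.H} (hα : α ∈ A.roots) (hδ : δ ∈ A.roots)
    (h0 : A.dualForm δ δ = 0) (hne : A.dualForm δ α ≠ 0) (N : ℕ) :
    ∃ n : ℤ, N ≤ |n| ∧ α + (n : ℂ) • δ ∈ A.roots := by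
  obtain ⟨v, hv, hv0⟩ := exists_ne_zero_of_mem_roots hα
  obtain ⟨x, hx, hx0⟩ := exists_ne_zero_of_mem_roots hδ
  obtain ⟨y, hy, hxy⟩ := exists_form_ne_zero hx hx0
  set X := LieModule.toEnd ℂ E E x
  set Y := LieModule.toEnd ℂ E E y
  by_cases hN : ∀ n : ℕ, (Y ^ n) v ≠ 0
  · refine ⟨-N, by simp, ?_⟩
    have h1 := mem_roots_of_ne_zero (toEnd_pow_mem_rootSpace hy hv N) (hN N)
    convert h1 using 1
    push_cast
    module
  classical
  push Not at hN
  have hpos : Nat.find hN ≠ 0 := fun hz => hv0 (by simpa [hz] using Nat.find_spec hN)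
  obtain ⟨k, hk⟩ := Nat.exists_eq_succ_of_ne_zero hpos
  set u := (Y ^ k) v
  have hu0 : u ≠ 0 := Nat.find_min hN (by omega)
  have hYu : ⁅y, u⁆ = 0 := by
    have := Nat.find_spec hN
    rwa [hk, pow_succ', Module.End.mul_apply] at this
  have hu : u ∈ A.rootSpace (α + (k : ℂ) • -δ) := toEnd_pow_mem_rootSpace hy hv k
  -- Heisenberg argument: `[x, y]` is a multiple of `t_δ` and `δ(t_δ) = 0`, so it acts on all `X ^ n
  -- u` by the same scalar `c ≠ 0`. As `y` kills `u`, it sends `X ^ (n + 1) u` to `-(n + 1) c` times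
  -- `X ^ n u`, so no `X ^ n u` vanishes.
  set c := A.form x y * A.dualForm δ α
  have hc : c ≠ 0 := mul_ne_zero hxy hne
  have hXu (n : ℕ) : (X ^ n) u ∈ A.rootSpace (α + (k : ℂ) • -δ + (n : ℂ) • δ) :=
    toEnd_pow_mem_rootSpace hx hu n
  have hcomm (n : ℕ) : ⁅⁅x, y⁆, (X ^ n) u⁆ = c • (X ^ n) u := by
    rw [lie_eq_form_smul_t hx hy, smul_lie, hXu n, smul_smul]
    simp [apply_t, h0, c]
  have hlower (n : ℕ) : ⁅y, (X ^ (n + 1)) u⁆ = (-(n + 1) * c) • (X ^ n) u := by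
    induction n with
    | zero =>
      have h1 := hcomm 0
      rw [pow_zero, Module.End.one_apply] at h1
      rw [zero_add, pow_one, pow_zero, Module.End.one_apply, LieModule.toEnd_apply_apply,
        leibniz_lie, hYu, lie_zero, add_zero, ← lie_skew y x, neg_lie, h1]
      simp
    | succ n ih =>
      rw [pow_succ', Module.End.mul_apply, LieModule.toEnd_apply_apply, leibniz_lie, ih,
        ← lie_skew y x, neg_lie, hcomm (n + 1), lie_smul]
      have : ⁅x, (X ^ n) u⁆ = (X ^ (n + 1)) u := by
        rw [pow_succ', Module.End.mul_apply, LieModule.toEnd_apply_apply]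
      rw [this]
      push_cast
      module
  have hX0 (n : ℕ) : (X ^ n) u ≠ 0 := by
    induction n with
    | zero => simpa using hu0
    | succ n ih =>
      intro h
      have h1 := hlower n
      rw [h, lie_zero] at h1
      refine smul_ne_zero (mul_ne_zero (neg_ne_zero.2 ?_) hc) ih h1.symm
      exact_mod_cast Nat.succ_ne_zero n
  refine ⟨N, by simp, ?_⟩
  -- The `k` extra steps undo the descent from `v` to `u`.
  have h1 := mem_roots_of_ne_zero (hXu (N + k)) (hX0 _)
  convert h1 using 1
  push_cast
  module

end SplitQuadraticLieAlgebra

/-! ### Cartan integers, one-dimensional root spaces, isotropic orthogonality -/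

namespace ExtendedAffineLieAlgebra

open Module SplitQuadraticLieAlgebra

variable {E : Type*} [LieRing E] [LieAlgebra ℂ E] {A : ExtendedAffineLieAlgebra E}

theorem neg_mem_nonisotropicRoots {α : Dual ℂ A.H} (hα : α ∈ A.nonisotropicRoots) :
    -α ∈ A.nonisotropicRoots :=
  ⟨neg_mem_roots hα.1, by simpa using hα.2⟩

/-- Root strings: Cartan integers are integers and the strings are symmetric, witnessed by
explicit non-zero products. -/
theorem exists_cartan_integer {α β : Dual ℂ A.H} (hα : α ∈ A.nonisotropicRoots)
    {e f x : E} (he : e ∈ A.rootSpace α) (hf : f ∈ A.rootSpace (-α))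
    (t : IsSl2Triple (A.coroot α : E) e f) (hx : x ∈ A.rootSpace β) (h0 : x ≠ 0) :
    ∃ d : ℤ, β (A.coroot α) = d ∧
      (0 ≤ d → ∃ j k : ℕ, (j : ℤ) - k = d ∧
        (LieModule.toEnd ℂ E E f ^ j) ((LieModule.toEnd ℂ E E e ^ k) x) ≠ 0) ∧
      (d ≤ 0 → ∃ j k : ℕ, (j : ℤ) - k = -d ∧
        (LieModule.toEnd ℂ E E e ^ j) ((LieModule.toEnd ℂ E E f ^ k) x) ≠ 0) := by
  have hne := A.ad_locally_nilpotent α hα e he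
  have hnf := A.ad_locally_nilpotent (-α) (neg_mem_nonisotropicRoots hα) f hf
  obtain ⟨d, hd, h1⟩ := t.exists_int_weight h0 (hx _) (hne x) hnf
  obtain ⟨d', hd', h2⟩ := t.symm.exists_int_weight (μ := -β (A.coroot α)) h0
    (by rw [neg_lie, hx, neg_smul]) (hnf x) hne
  have h3 : d' = -d := by
    rw [hd] at hd'
    exact_mod_cast hd'.symm
  refine ⟨d, hd, h1, fun h => ?_⟩
  subst h3
  exact h2 (by omega)

theorem exists_apply_coroot_eq {α β : Dual ℂ A.H} (hα : α ∈ A.nonisotropicRoots)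
    (hβ : β ∈ A.roots) : ∃ d : ℤ, β (A.coroot α) = d := by
  obtain ⟨e, he, h0⟩ := exists_ne_zero_of_mem_roots hα.1
  obtain ⟨f, hf, t⟩ := exists_isSl2Triple hα he h0
  obtain ⟨x, hx, hx0⟩ := exists_ne_zero_of_mem_roots hβ
  obtain ⟨d, hd, -⟩ := exists_cartan_integer hα he hf t hx hx0
  exact ⟨d, hd⟩

/-- Correct `x` by a multiple of `e` to a vector `z` orthogonal to `f`; then `[f, z] = 0`. A
non-zero `z` would be primitive of weight `-2` for the triple with `e` and `f` exchanged, while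
local nilpotency allows only weights in `ℕ`. -/
theorem exists_smul_eq {α : Dual ℂ A.H} (hα : α ∈ A.nonisotropicRoots) {e x : E}
    (he : e ∈ A.rootSpace α) (h0 : e ≠ 0) (hx : x ∈ A.rootSpace α) : ∃ c : ℂ, x = c • e := by
  obtain ⟨f, hf, t⟩ := exists_isSl2Triple hα he h0
  have hef : A.form e f ≠ 0 := by
    intro h
    apply t.h_ne_zero
    rw [← t.lie_e_f, lie_eq_form_smul_t he hf, h, zero_smul]
  set z := x - (A.form x f / A.form e f) • e
  have hz : z ∈ A.rootSpace α := Submodule.sub_mem _ hx (Submodule.smul_mem _ _ he)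
  have hfz : ⁅f, z⁆ = 0 := by
    rw [← lie_skew, lie_eq_form_smul_t hz hf]
    have : A.form z f = 0 := by simp [z, hef]
    rw [this, zero_smul, neg_zero]
  refine ⟨A.form x f / A.form e f, sub_eq_zero.1 ?_⟩
  change z = 0
  by_contra hz0
  have h2 : α (A.coroot α) = 2 := by
    rw [apply_coroot, mul_div_assoc, div_self hα.2, mul_one]
  have P : t.symm.HasPrimitiveVectorWith z (-2 : ℂ) :=
    ⟨hz0, by rw [neg_lie, hz, h2, neg_smul], hfz⟩
  obtain ⟨N, hN⟩ := P.exists_eq_natCast (A.ad_locally_nilpotent α hα e he z)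
  have : ((N + 2 : ℕ) : ℂ) = 0 := by
    push_cast
    rw [← hN]
    ring
  exact (Nat.cast_ne_zero.2 (by omega)) this

/-- Isotropic roots are orthogonal to the non-isotropic ones. -/
theorem dualForm_eq_zero {α δ : Dual ℂ A.H} (hα : α ∈ A.nonisotropicRoots)
    (hδ : δ ∈ A.isotropicRoots) : A.dualForm δ α = 0 := by
  by_contra hne
  set a := A.dualForm α α
  set c := A.dualForm δ α
  have hc : 0 < ‖c‖ := norm_pos_iff.2 hne
  -- For `γ = α + n δ`, the Cartan integer of `δ` against `γ` is `2c / (a + 2nc)`. The bound on `N`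
  -- makes the denominator exceed `2‖c‖` in norm, so this non-zero integer would have norm below
  -- `1`.
  obtain ⟨N, hN⟩ := exists_nat_gt ((‖a‖ + 2 * ‖c‖) / (2 * ‖c‖))
  obtain ⟨n, hn, hroot⟩ := exists_root_string hα.1 hδ.1 hδ.2 hne N
  rw [div_lt_iff₀ (by positivity)] at hN
  have hnorm : (N : ℝ) ≤ ‖(n : ℂ)‖ := by
    rw [Complex.norm_intCast]
    exact_mod_cast hn
  have hγγ : A.dualForm (α + (n : ℂ) • δ) (α + (n : ℂ) • δ) = a + 2 * n * c := by
    simp only [map_add, LinearMap.add_apply, map_smul, LinearMap.smul_apply, smul_eq_mul, hδ.2,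
      dualForm_comm α δ]
    ring
  have hγδ : A.dualForm (α + (n : ℂ) • δ) δ = c := by
    simp only [map_add, LinearMap.add_apply, map_smul, LinearMap.smul_apply, smul_eq_mul, hδ.2,
      dualForm_comm α δ]
    ring
  have hlarge : 2 * ‖c‖ < ‖a + 2 * n * c‖ := by
    have h1 : ‖2 * (n : ℂ) * c‖ = 2 * ‖(n : ℂ)‖ * ‖c‖ := by simp
    have h2 : ‖2 * (n : ℂ) * c‖ ≤ ‖a + 2 * n * c‖ + ‖a‖ := by
      simpa using norm_sub_le (a + 2 * n * c) a
    nlinarith [mul_le_mul_of_nonneg_right hnorm hc.le]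
  have hne' : a + 2 * n * c ≠ 0 := norm_pos_iff.1 (by linarith)
  obtain ⟨d, hd⟩ := exists_apply_coroot_eq (A := A) ⟨hroot, hγγ ▸ hne'⟩ hδ.1
  rw [apply_coroot, hγγ, hγδ, div_eq_iff hne'] at hd
  have hd0 : d ≠ 0 := by
    rintro rfl
    simp [hne] at hd
  have h1 : (1 : ℝ) ≤ ‖(d : ℂ)‖ := by
    rw [Complex.norm_intCast]
    exact_mod_cast Int.one_le_abs hd0
  have h2 := congrArg norm hd
  rw [norm_mul, norm_mul, Complex.norm_two] at h2
  nlinarith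

end ExtendedAffineLieAlgebra

/-! ### The core and the reflection group -/

namespace SplitQuadraticLieAlgebra

open Module

variable {E : Type*} [LieRing E] [LieAlgebra ℂ E] {A : SplitQuadraticLieAlgebra E}

theorem core_le {K : LieSubalgebra ℂ E}
    (h : ∀ α ∈ A.nonisotropicRoots, ∀ x ∈ A.rootSpace α, x ∈ K) : A.core ≤ K :=
  LieSubalgebra.lieSpan_le.2 fun x ⟨α, hα, hx⟩ => h α hα x hx

theorem lie_core_eq_zero {x : E}
    (h : ∀ α ∈ A.nonisotropicRoots, ∀ y ∈ A.rootSpace α, ⁅x, y⁆ = 0) {y : E} (hy : y ∈ A.core) :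
    ⁅x, y⁆ = 0 := by
  let K : LieSubalgebra ℂ E :=
    { LinearMap.ker (LieModule.toEnd ℂ E E x) with
      lie_mem' := fun {y z} (hy : ⁅x, y⁆ = 0) (hz : ⁅x, z⁆ = 0) => by
        change ⁅x, ⁅y, z⁆⁆ = 0
        rw [leibniz_lie, hy, hz, zero_lie, lie_zero, add_zero] }
  exact core_le (K := K) h hy

theorem apply_eq_self_of_mem_core {Φ : E ≃ₗ⁅ℂ⁆ E}
    (h : ∀ α ∈ A.nonisotropicRoots, ∀ y ∈ A.rootSpace α, Φ y = y) {y : E} (hy : y ∈ A.core) :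
    Φ y = y := by
  let K : LieSubalgebra ℂ E :=
    { carrier := {y | Φ y = y}
      add_mem' := fun {y z} (hy : Φ y = y) (hz : Φ z = z) => by
        change Φ (y + z) = y + z
        rw [map_add, hy, hz]
      zero_mem' := map_zero Φ
      smul_mem' := fun c y (hy : Φ y = y) => by
        change Φ (c • y) = c • y
        rw [map_smul, hy]
      lie_mem' := fun {y z} (hy : Φ y = y) (hz : Φ z = z) => by
        change Φ ⁅y, z⁆ = ⁅y, z⁆
        rw [LieEquiv.map_lie, hy, hz] }
  exact core_le (K := K) h hy

/-- The core is supported in degrees belonging to the lattice of the non-isotropic roots. -/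
theorem core_le_iSup {S : AddSubgroup (Dual ℂ A.H)} (hS : A.nonisotropicRoots ⊆ S) {x : E}
    (hx : x ∈ A.core) : x ∈ ⨆ γ : S, A.rootSpace γ := by
  let K : LieSubalgebra ℂ E :=
    { (⨆ γ : S, A.rootSpace γ : Submodule ℂ E) with
      lie_mem' := fun {x y} (hx : x ∈ ⨆ γ : S, A.rootSpace γ)
          (hy : y ∈ ⨆ γ : S, A.rootSpace γ) => by
        change ⁅x, y⁆ ∈ ⨆ γ : S, A.rootSpace γ
        refine Submodule.iSup_induction _ (motive := fun x => ⁅x, y⁆ ∈ ⨆ γ : S, A.rootSpace γ) hx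
          (fun α x hx => ?_) (by simp) fun x z hx hz => by
            rw [add_lie]
            exact add_mem hx hz
        refine Submodule.iSup_induction _ (motive := fun y => ⁅x, y⁆ ∈ ⨆ γ : S, A.rootSpace γ) hy
          (fun β y hy => ?_) (by simp) fun y z hy hz => by
            rw [lie_add]
            exact add_mem hy hz
        exact Submodule.mem_iSup_of_mem (α + β) (lie_mem_rootSpace hx hy) }
  exact core_le (K := K) (fun α hα x hx => Submodule.mem_iSup_of_mem ⟨α, hS hα⟩ hx) hx

/-- The core is supported on `S`, and the root spaces are independent. -/
theorem eq_zero_of_mem_core {S : AddSubgroup (Dual ℂ A.H)} (hS : A.nonisotropicRoots ⊆ S)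
    {δ : Dual ℂ A.H} (hδ : δ ∉ S) {x : E} (hx : x ∈ A.rootSpace δ) (hc : x ∈ A.core) : x = 0 := by
  have h1 := A.iSupIndep_rootSpace.disjoint_biSup (y := (S : Set (Dual ℂ A.H))) hδ
  refine Submodule.disjoint_def.1 h1 x hx ?_
  have h2 := core_le_iSup hS hc
  rwa [iSup_subtype'] at *

theorem reflection_reflection (α : Dual ℂ A.H) (hα : A.dualForm α α ≠ 0) :
    A.reflection α hα * A.reflection α hα = 1 := by
  ext1 β
  exact Module.involutive_reflection _ β

theorem reflection_mem_nonisotropicRoots {P : Set (Dual ℂ A.H)}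
    (hP : A.reflectionOrbit P = A.nonisotropicRoots) {α β : Dual ℂ A.H} (hα : α ∈ P)
    (h0 : A.dualForm α α ≠ 0) (hβ : β ∈ A.nonisotropicRoots) :
    A.reflection α h0 β ∈ A.nonisotropicRoots := by
  rw [← hP] at hβ ⊢
  obtain ⟨w, hw, b, hb, rfl⟩ := hβ
  exact ⟨A.reflection α h0 * w, mul_mem (Subgroup.subset_closure ⟨α, h0, hα, rfl⟩) hw, b, hb, rfl⟩

/-- To prove a property of all non-isotropic roots, it suffices to prove it on a reflectable set
and to show that it is preserved by the reflections in the elements of this set. -/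
theorem nonisotropicRoots_induction {P : Set (Dual ℂ A.H)} (hPR : P ⊆ A.nonisotropicRoots)
    (hP : A.reflectionOrbit P = A.nonisotropicRoots) {p : Dual ℂ A.H → Prop}
    (base : ∀ α ∈ P, p α)
    (step : ∀ α ∈ P, ∀ h0 : A.dualForm α α ≠ 0, ∀ β ∈ A.nonisotropicRoots,
      A.reflection α h0 β ∈ A.nonisotropicRoots → p β → p (A.reflection α h0 β))
    {β : Dual ℂ A.H} (hβ : β ∈ A.nonisotropicRoots) : p β := by
  rw [← hP] at hβ
  obtain ⟨w, hw, b, hb, rfl⟩ := hβ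
  suffices h : w b ∈ A.nonisotropicRoots ∧ p (w b) from h.2
  have key (α : Dual ℂ A.H) (hα : α ∈ P) (h0 : A.dualForm α α ≠ 0) (γ : Dual ℂ A.H)
      (h : γ ∈ A.nonisotropicRoots ∧ p γ) :
      A.reflection α h0 γ ∈ A.nonisotropicRoots ∧ p (A.reflection α h0 γ) :=
    have h1 := reflection_mem_nonisotropicRoots hP hα h0 h.1
    ⟨h1, step α hα h0 γ h.1 h1 h.2⟩
  induction hw using Subgroup.closure_induction_left with
  | one => exact ⟨hPR hb, base b hb⟩
  | mul_left x hx y hy ih =>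
    obtain ⟨α, h0, hα, rfl⟩ := hx
    exact key α hα h0 _ ih
  | inv_mul_cancel x hx y hy ih =>
    obtain ⟨α, h0, hα, rfl⟩ := hx
    rw [inv_eq_of_mul_eq_one_left (reflection_reflection α h0)]
    exact key α hα h0 _ ih

theorem reflection_apply_eq_coroot (α : Dual ℂ A.H) (hα : A.dualForm α α ≠ 0) (β : Dual ℂ A.H) :
    A.reflection α hα β = β - β (A.coroot α) • α := by
  rw [reflection_apply, apply_coroot]

theorem mem_rootLattice {α : Dual ℂ A.H} (hα : α ∈ A.roots) : α ∈ A.rootLattice :=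
  Submodule.subset_span hα

/-- The character of the root system obtained by restricting a homomorphism defined on the
root lattice. -/
def characterOfHom (φ : A.rootLattice →ₗ[ℤ] Additive ℂˣ) : A.characterGroup :=
  ⟨fun α => (φ ⟨α, mem_rootLattice α.2⟩).toMul, fun α β γ h => by
    rw [← toMul_add, ← map_add]
    exact congrArg (fun γ => (φ γ).toMul) (Subtype.ext h)⟩

theorem lieAut_pow_apply_of_eq_smul {σ : E ≃ₗ⁅ℂ⁆ E} {x : E} {c : ℂ} (h : σ x = c • x) (n : ℕ) :
    (σ ^ n) x = c ^ n • x := by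
  induction n with
  | zero => simp
  | succ n ih =>
    rw [pow_succ, lieAut_mul_apply, h, map_smul, ih, smul_smul, pow_succ']

theorem lieAut_toEnd_pow_apply (σ : E ≃ₗ⁅ℂ⁆ E) {e x : E} {a b : ℂ} (he : σ e = a • e)
    (hx : σ x = b • x) (n : ℕ) :
    σ ((LieModule.toEnd ℂ E E e ^ n) x) = (a ^ n * b) • (LieModule.toEnd ℂ E E e ^ n) x := by
  induction n with
  | zero => simpa using hx
  | succ n ih =>
    rw [pow_succ', Module.End.mul_apply, LieModule.toEnd_apply_apply, LieEquiv.map_lie, he, ih,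
      smul_lie, lie_smul, smul_smul, pow_succ', mul_assoc]

end SplitQuadraticLieAlgebra

/-! ### The root lattice in index zero and diagonality of Cartan automorphisms -/

namespace ExtendedAffineLieAlgebra

open Module SplitQuadraticLieAlgebra

variable {E : Type*} [LieRing E] [LieAlgebra ℂ E] {A : ExtendedAffineLieAlgebra E}

theorem add_mem_nonisotropicRoots {α δ : Dual ℂ A.H} (hα : α ∈ A.nonisotropicRoots)
    (hδ : δ ∈ A.isotropicRoots) (h : δ + α ∈ A.roots) : δ + α ∈ A.nonisotropicRoots := by
  refine ⟨h, ?_⟩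
  have h1 := dualForm_eq_zero hα hδ
  simp only [map_add, LinearMap.add_apply, hδ.2, h1, dualForm_comm α δ]
  simpa using hα.2

/-- The root lattice is spanned by the non-isotropic roots. -/
theorem rootLattice_le_span_nonisotropicRoots :
    A.rootLattice ≤ Submodule.span ℤ A.nonisotropicRoots := by
  refine Submodule.span_le.2 fun δ hδ => ?_
  set S := Submodule.span ℤ A.nonisotropicRoots
  have hS : A.nonisotropicRoots ⊆ S.toAddSubgroup := Submodule.subset_span
  by_cases h0 : A.dualForm δ δ = 0
  · by_contra hnot
    obtain ⟨x, hx, hx0⟩ := exists_ne_zero_of_mem_roots hδ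
    -- If `[x, y] ≠ 0` with `y ∈ E_α`, then `δ + α` is a non-isotropic root and `δ = (δ + α) - α`
    -- lies in the span. Otherwise `x` centralizes the core and tameness puts it there, in a degree
    -- the core does not have.
    refine hx0 (eq_zero_of_mem_core hS hnot hx (A.tame x fun y hy => lie_core_eq_zero ?_ hy))
    intro α hα y hy
    by_contra hxy
    have h1 := add_mem_nonisotropicRoots hα ⟨hδ, h0⟩
      (mem_roots_of_ne_zero (lie_mem_rootSpace hx hy) hxy)
    apply hnot
    have h2 := S.sub_mem (hS h1) (hS hα)
    rwa [add_sub_cancel_right] at h2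
  · exact hS ⟨hδ, h0⟩

theorem span_eq_rootLattice {P : Set (Dual ℂ A.H)} (hPR : P ⊆ A.nonisotropicRoots)
    (hP : A.reflectionOrbit P = A.nonisotropicRoots) :
    Submodule.span ℤ P = A.rootLattice := by
  refine le_antisymm (Submodule.span_mono (hPR.trans fun α hα => hα.1))
    (rootLattice_le_span_nonisotropicRoots.trans (Submodule.span_le.2 fun β hβ => ?_))
  refine nonisotropicRoots_induction (p := fun β => β ∈ Submodule.span ℤ P) hPR hP
    (fun α hα => Submodule.subset_span hα) (fun α hα h0 β hβ _ h => ?_) hβ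
  obtain ⟨d, hd⟩ := exists_apply_coroot_eq (hPR hα) hβ.1
  rw [reflection_apply_eq_coroot, hd, Int.cast_smul_eq_zsmul]
  exact sub_mem h (Submodule.smul_mem _ _ (Submodule.subset_span hα))

/-- A map on a reflectable set whose cardinality is the rank of the root lattice extends to a
homomorphism on the root lattice. -/
theorem exists_hom_eqOn {P : Set (Dual ℂ A.H)} (hPR : P ⊆ A.nonisotropicRoots)
    (hP : A.reflectionOrbit P = A.nonisotropicRoots) (hfin : P.Finite)
    (hcard : P.ncard = Module.finrank ℤ A.rootLattice) (c : P → ℂˣ) :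
    ∃ φ : A.rootLattice →ₗ[ℤ] Additive ℂˣ,
      (∀ p : P, φ ⟨p, mem_rootLattice (hPR p.2).1⟩ = Additive.ofMul (c p)) ∧
      ∀ n : ℕ, (∀ p, c p ^ n = 1) → n • φ = 0 := by
  have := A.rootLattice_free
  have := A.rootLattice_finite
  have := hfin.fintype
  let b : P → A.rootLattice := fun p => ⟨p, mem_rootLattice (hPR p.2).1⟩
  have hb : ⊤ ≤ Submodule.span ℤ (Set.range b) := by
    rintro ⟨x, hx⟩ -
    have hx' : x ∈ (Submodule.span ℤ (Set.range b)).map A.rootLattice.subtype := by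
      rw [Submodule.map_span, ← Set.range_comp]
      have : Set.range (A.rootLattice.subtype ∘ b) = P := Subtype.range_coe
      rwa [this, span_eq_rootLattice hPR hP]
    obtain ⟨y, hy, rfl⟩ := hx'
    exact hy
  have hc : Fintype.card P = Module.finrank ℤ A.rootLattice := by
    rw [← hcard, ← Nat.card_coe_set_eq, Nat.card_eq_fintype_card]
  -- A spanning family with as many members as the rank of a free module of finite rank is a basis.
  let B := Basis.mk (linearIndependent_of_top_le_span_of_card_eq_finrank hb hc) hb
  have hB (p : P) : B.constr ℤ (fun p => Additive.ofMul (c p)) (b p) = Additive.ofMul (c p) := by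
    rw [← Basis.mk_apply (linearIndependent_of_top_le_span_of_card_eq_finrank hb hc) hb p,
      Basis.constr_basis]
  refine ⟨B.constr ℤ fun p => Additive.ofMul (c p), hB, fun n hn => B.ext fun p => ?_⟩
  rw [LinearMap.smul_apply, Basis.constr_basis, ← ofMul_pow, hn, ofMul_one, LinearMap.zero_apply]

theorem exists_unit_smul_eq {Ψ : E ≃ₗ⁅ℂ⁆ E} (hΨ : Ψ ∈ A.cartanAut) {α : Dual ℂ A.H}
    (hα : α ∈ A.nonisotropicRoots) : ∃ c : ℂˣ, ∀ x ∈ A.rootSpace α, Ψ x = (c : ℂ) • x := by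
  obtain ⟨e, he, h0⟩ := exists_ne_zero_of_mem_roots hα.1
  obtain ⟨c, hc⟩ := exists_smul_eq hα he h0 (cartanAut_apply_mem_rootSpace hΨ he)
  have hc0 : c ≠ 0 := by
    rintro rfl
    rw [zero_smul] at hc
    exact h0 ((map_eq_zero_iff Ψ Ψ.injective).1 hc)
  refine ⟨Units.mk0 c hc0, fun x hx => ?_⟩
  obtain ⟨a, rfl⟩ := exists_smul_eq hα he h0 hx
  rw [map_smul, hc, Units.val_mk0, smul_comm]

/-- A Cartan automorphism acting on `E_α` and `E_β` by scalars `a` and `b` acts on the root space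
of the reflected root `β - d α` by `b a⁻ᵈ`. -/
theorem apply_of_mem_rootSpace_reflection {Ψ : E ≃ₗ⁅ℂ⁆ E} (hΨ : Ψ ∈ A.cartanAut)
    {α β γ : Dual ℂ A.H} (hα : α ∈ A.nonisotropicRoots) (hβ : β ∈ A.roots)
    (hγ : γ ∈ A.nonisotropicRoots) {d : ℤ} (hd : β (A.coroot α) = d) (hβγ : γ = β - d • α)
    {a b : ℂˣ} (ha : ∀ x ∈ A.rootSpace α, Ψ x = (a : ℂ) • x)
    (hb : ∀ x ∈ A.rootSpace β, Ψ x = (b : ℂ) • x) {x : E} (hx : x ∈ A.rootSpace γ) :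
    Ψ x = ((b / a ^ d : ℂˣ) : ℂ) • x := by
  obtain ⟨e, he, h0⟩ := exists_ne_zero_of_mem_roots hα.1
  obtain ⟨f, hf, t⟩ := exists_isSl2Triple hα he h0
  obtain ⟨y, hy, hy0⟩ := exists_ne_zero_of_mem_roots hβ
  have hΨe := ha e he
  -- `[e, f]` lies in `H` and is fixed by `Ψ`, so the scalars on `e` and `f` are inverse to each
  -- other.
  have hΨf : Ψ f = ((a⁻¹ : ℂˣ) : ℂ) • f := by
    obtain ⟨c, hc⟩ := exists_unit_smul_eq hΨ (neg_mem_nonisotropicRoots hα)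
    have h1 : Ψ ⁅e, f⁆ = ⁅e, f⁆ := by
      rw [t.lie_e_f]
      exact hΨ _ (A.coroot α).2
    rw [LieEquiv.map_lie, hΨe, hc f hf, smul_lie, lie_smul, smul_smul, t.lie_e_f] at h1
    have h2 : ((a * c : ℂˣ) : ℂ) = (1 : ℂ) :=
      smul_left_injective ℂ t.h_ne_zero (by simpa using h1)
    rw [hc f hf, ← eq_inv_of_mul_eq_one_right (Units.ext h2)]
  obtain ⟨d', hd', hpos, hneg⟩ := exists_cartan_integer hα he hf t hy hy0
  obtain rfl : d' = d := by
    rw [hd] at hd'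
    exact_mod_cast hd'.symm
  have hcast (n : ℕ) (v : Dual ℂ A.H) : (n : ℂ) • v = n • v := Nat.cast_smul_eq_nsmul ℂ n v
  -- `E_γ` is a line, so one non-zero vector decides. For `d' ≥ 0` it is `f ^ j e ^ k y` with `j - k
  -- = d'`, scaled by `a ^ (k - j) b`; for `d' ≤ 0` the roles of `e` and `f` are exchanged.
  suffices h : ∃ z ∈ A.rootSpace γ, z ≠ 0 ∧ Ψ z = ((b / a ^ d' : ℂˣ) : ℂ) • z by
    obtain ⟨z, hz, hz0, hΨz⟩ := h
    obtain ⟨c, rfl⟩ := exists_smul_eq hγ hz hz0 hx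
    rw [map_smul, hΨz, smul_comm]
  rcases le_total 0 d' with h | h
  · obtain ⟨j, k, hjk, hz⟩ := hpos h
    have h1 := toEnd_pow_mem_rootSpace hf (toEnd_pow_mem_rootSpace he hy k) j
    refine ⟨_, ?_, hz, ?_⟩
    · convert h1 using 1
      rw [hβγ, ← hjk, hcast, hcast, sub_smul, natCast_zsmul, natCast_zsmul, smul_neg,
        sub_sub_eq_add_sub, sub_eq_add_neg]
    · rw [lieAut_toEnd_pow_apply Ψ hΨf (lieAut_toEnd_pow_apply Ψ hΨe (hb y hy) k) j]
      congr 1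
      norm_cast
      rw [← hjk, zpow_sub, zpow_natCast, zpow_natCast]
      simp only [div_eq_mul_inv, mul_inv_rev, inv_inv, inv_pow]
      ac_rfl
  · obtain ⟨j, k, hjk, hz⟩ := hneg h
    have h1 := toEnd_pow_mem_rootSpace he (toEnd_pow_mem_rootSpace hf hy k) j
    refine ⟨_, ?_, hz, ?_⟩
    · convert h1 using 1
      rw [hβγ, ← neg_neg d', ← hjk, hcast, hcast, neg_smul, sub_smul, natCast_zsmul,
        natCast_zsmul, smul_neg, neg_sub, sub_sub_eq_add_sub, sub_eq_add_neg, add_right_comm]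
    · rw [lieAut_toEnd_pow_apply Ψ hΨe (lieAut_toEnd_pow_apply Ψ hΨf (hb y hy) k) j]
      congr 1
      norm_cast
      rw [← neg_neg d', ← hjk, neg_sub, zpow_sub, zpow_natCast, zpow_natCast]
      simp only [div_eq_mul_inv, mul_inv_rev, inv_inv, inv_pow]
      ac_rfl

/-- An automorphism of finite order which fixes the non-isotropic root spaces pointwise
is the identity. -/
theorem eq_one_of_apply_eq_self {Φ : E ≃ₗ⁅ℂ⁆ E} (hfin : IsOfFinOrder Φ)
    (h : ∀ α ∈ A.nonisotropicRoots, ∀ x ∈ A.rootSpace α, Φ x = x) : Φ = 1 := by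
  refine lieAut_ext_rootSpace (A := A.toSplitQuadraticLieAlgebra) fun δ x hx => ?_
  change Φ x = x
  by_cases hx0 : x = 0
  · rw [hx0, map_zero]
  have hδ := mem_roots_of_ne_zero hx hx0
  by_cases h0 : A.dualForm δ δ ≠ 0
  · exact h δ ⟨hδ, h0⟩ x hx
  rw [not_not] at h0
  set z := Φ x - x with hz
  -- For `y ∈ E_α`, the bracket `[x, y]` is zero or of non-isotropic degree `δ + α`, hence fixed by
  -- `Φ`, as is `y`. So `[z, y] = 0`, and tameness applies.
  have hzc : z ∈ A.core := by
    refine A.tame z fun y hy => lie_core_eq_zero (fun α hα y hy => ?_) hy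
    have h1 : Φ ⁅x, y⁆ = ⁅x, y⁆ := by
      by_cases hxy : ⁅x, y⁆ = 0
      · rw [hxy, map_zero]
      · have h2 := lie_mem_rootSpace hx hy
        exact h _ (add_mem_nonisotropicRoots hα ⟨hδ, h0⟩ (mem_roots_of_ne_zero h2 hxy)) _ h2
    rw [LieEquiv.map_lie, h α hα y hy] at h1
    rw [hz, sub_lie, h1, sub_self]
  have hΦz := apply_eq_self_of_mem_core h hzc
  have hpow (n : ℕ) : (Φ ^ n) x = x + n • z := by
    induction n with
    | zero => simp
    | succ n ih =>
      rw [pow_succ', lieAut_mul_apply, ih, map_add, map_nsmul, hΦz, succ_nsmul', hz]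
      abel
  obtain ⟨n, hn, hn1⟩ := isOfFinOrder_iff_pow_eq_one.1 hfin
  have h1 := hpow n
  change _ = x + n • z at h1
  rw [hn1] at h1
  have h2 : n • z = 0 := left_eq_add.1 h1
  rw [← Nat.cast_smul_eq_nsmul ℂ] at h2
  exact sub_eq_zero.1 ((smul_eq_zero.1 h2).resolve_left (Nat.cast_ne_zero.2 hn.ne'))

theorem exists_reflectable_ncard_eq (hrank : 1 < A.rank) (hind : A.ind = 0) :
    ∃ P : Set (Dual ℂ A.H), P ⊆ A.nonisotropicRoots ∧
      A.reflectionOrbit P = A.nonisotropicRoots ∧ P.Finite ∧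
      P.ncard = Module.finrank ℤ A.rootLattice := by
  have hrefl : A.refl = Module.finrank ℤ A.rootLattice := by
    have := sub_eq_zero.1 hind
    exact_mod_cast this
  rcases Set.eq_empty_or_nonempty {n | ∃ P, A.IsReflectableBase P ∧ P.Finite ∧ P.ncard = n}
    with h | h
  -- `sInf ∅ = 0`: without a finite reflectable base, index zero would make the root lattice
  -- trivial, against `1 < A.rank`.
  · exfalso
    have h0 : A.refl = 0 := by rw [SplitQuadraticLieAlgebra.refl, h, Nat.sInf_empty]
    have := A.rootLattice_free
    have := A.rootLattice_finite
    rw [h0] at hrefl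
    have hsub : Subsingleton A.rootLattice := Module.finrank_zero_iff.1 hrefl.symm
    have hroots (α : Dual ℂ A.H) (hα : α ∈ A.roots) : α = 0 :=
      congrArg Subtype.val (Subsingleton.elim (⟨α, mem_rootLattice hα⟩ : A.rootLattice) 0)
    have hbar : Submodule.span ℝ A.rootsBar = ⊥ := by
      rw [Submodule.span_eq_bot]
      rintro _ ⟨α, hα, rfl⟩
      rw [hroots α hα, map_zero]
    rw [rank, hbar, finrank_bot] at hrank
    exact absurd hrank (by omega)
  · obtain ⟨P, hP, hfin, hcard⟩ := Nat.sInf_mem h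
    exact ⟨P, hP.1, hP.2.1, hfin, hcard.trans hrefl⟩

/-- In index zero, Cartan automorphisms of finite order are diagonal. -/
theorem exists_diagonalAut_eq (hrank : 1 < A.rank) (hind : A.ind = 0) {Ψ : E ≃ₗ⁅ℂ⁆ E}
    (hΨ : Ψ ∈ A.cartanAut) (hfin : IsOfFinOrder Ψ) :
    ∃ ψ : A.characterGroup, A.diagonalAut ψ = Ψ := by
  obtain ⟨P, hPR, hP, hPfin, hcard⟩ := exists_reflectable_ncard_eq hrank hind
  choose c hc using fun p : P => exists_unit_smul_eq hΨ (hPR p.2)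
  obtain ⟨φ, hφ, hφn⟩ := exists_hom_eqOn hPR hP hPfin hcard c
  have key {β : Dual ℂ A.H} (hβ : β ∈ A.nonisotropicRoots) :
      ∀ (h : β ∈ A.rootLattice), ∀ x ∈ A.rootSpace β, Ψ x = ((φ ⟨β, h⟩).toMul : ℂ) • x := by
    refine nonisotropicRoots_induction (p := fun β => ∀ (h : β ∈ A.rootLattice),
      ∀ x ∈ A.rootSpace β, Ψ x = ((φ ⟨β, h⟩).toMul : ℂ) • x) hPR hP
      (fun α hα _ x hx => ?_) (fun α hα h0 β hβ hγ ih h x hx => ?_) hβ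
    · rw [hφ ⟨α, hα⟩]
      exact hc ⟨α, hα⟩ x hx
    · obtain ⟨d, hd⟩ := exists_apply_coroot_eq (hPR hα) hβ.1
      have h1 : A.reflection α h0 β = β - d • α := by
        rw [reflection_apply_eq_coroot, hd, Int.cast_smul_eq_zsmul]
      have hα' := mem_rootLattice (hPR hα).1
      have hβ' := mem_rootLattice hβ.1
      have h2 : (⟨A.reflection α h0 β, h⟩ : A.rootLattice) = ⟨β, hβ'⟩ - d • ⟨α, hα'⟩ :=
        Subtype.ext h1
      rw [apply_of_mem_rootSpace_reflection hΨ (hPR hα) hβ.1 hγ hd h1 (hc ⟨α, hα⟩) (ih hβ') hx,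
        h2, map_sub, map_zsmul, hφ ⟨α, hα⟩, toMul_sub, toMul_zsmul, toMul_ofMul]
  refine ⟨characterOfHom φ, ?_⟩
  obtain ⟨n, hn, hn1⟩ := isOfFinOrder_iff_pow_eq_one.1 hfin
  -- `Ψ ^ n = 1` makes the scalars on `P` `n`-th roots of unity; as `P` spans the lattice, the
  -- character built from them has finite order too.
  have hcn (p : P) : c p ^ n = 1 := by
    obtain ⟨x, hx, hx0⟩ := exists_ne_zero_of_mem_roots (hPR p.2).1
    have h1 := lieAut_pow_apply_of_eq_smul (hc p x hx) n
    rw [hn1] at h1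
    refine Units.ext (smul_left_injective ℂ hx0 ?_)
    simpa using h1.symm
  have hφfin : IsOfFinOrder (characterOfHom φ) := by
    refine isOfFinOrder_iff_pow_eq_one.2 ⟨n, hn, Subtype.ext (funext fun α => ?_)⟩
    have h1 := LinearMap.congr_fun (hφn n hcn) ⟨α, mem_rootLattice α.2⟩
    exact congrArg Additive.toMul h1
  have hcomm : Commute (A.diagonalAut (characterOfHom φ))⁻¹ Ψ :=
    (commute_diagonalAut _ hΨ).inv_left
  have hDfin : IsOfFinOrder (A.diagonalAut (characterOfHom φ)) :=
    MonoidHom.isOfFinOrder _ hφfin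
  refine inv_mul_eq_one.1 (eq_one_of_apply_eq_self (A := A)
    (hcomm.isOfFinOrder_mul hDfin.inv hfin) fun α hα x hx => ?_)
  have h1 : A.diagonalAut (characterOfHom φ) x = Ψ x :=
    (diagonalAut_apply _ ⟨α, hα.1⟩ hx).trans (key hα _ x hx).symm
  rw [lieAut_mul_apply, ← h1, ← lieAut_mul_apply, inv_mul_cancel]
  rfl

end ExtendedAffineLieAlgebra

/-! ### Chevalley involutions -/

namespace SplitQuadraticLieAlgebra

open Module

variable {E : Type*} [LieRing E] [LieAlgebra ℂ E] {A : SplitQuadraticLieAlgebra E}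

theorem apply_neg_root (ψ : A.characterGroup) (α : A.roots) :
    (ψ : A.roots → ℂˣ) ⟨-α, neg_mem_roots α.2⟩ * (ψ : A.roots → ℂˣ) α = 1 := by
  rw [← ψ.2 ⟨-α, neg_mem_roots α.2⟩ α ⟨0, zero_mem_roots⟩ (by simp), character_apply_zero]

theorem apply_mem_rootSpace_neg {τ : E ≃ₗ⁅ℂ⁆ E} (hτ : ∀ h ∈ A.H, τ h = -h) {α : Dual ℂ A.H}
    {x : E} (hx : x ∈ A.rootSpace α) : τ x ∈ A.rootSpace (-α) := fun h => by
  have h1 : τ (-(h : E)) = h := by rw [map_neg, hτ h h.2, neg_neg]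
  calc ⁅(h : E), τ x⁆ = ⁅τ (-(h : E)), τ x⁆ := by rw [h1]
    _ = τ ⁅-(h : E), x⁆ := (LieEquiv.map_lie τ _ _).symm
    _ = (-α) h • τ x := by rw [neg_lie, hx h, ← neg_smul, map_smul, LinearMap.neg_apply]

/-- Automorphisms acting as `-1` on `H` invert the diagonal automorphisms. -/
theorem diagonalAut_mul_mul_diagonalAut {τ : E ≃ₗ⁅ℂ⁆ E} (hτ : ∀ h ∈ A.H, τ h = -h)
    (ψ : A.characterGroup) : A.diagonalAut ψ * τ * A.diagonalAut ψ = τ := by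
  refine lieAut_ext_rootSpace (A := A) fun α x hx => ?_
  by_cases hx0 : x = 0
  · simp [hx0]
  have hα := mem_roots_of_ne_zero hx hx0
  rw [lieAut_mul_apply, lieAut_mul_apply, diagonalAut_apply ψ ⟨α, hα⟩ hx, map_smul, map_smul,
    diagonalAut_apply ψ ⟨-α, neg_mem_roots hα⟩ (apply_mem_rootSpace_neg hτ hx), smul_smul,
    ← Units.val_mul, mul_comm, apply_neg_root ψ ⟨α, hα⟩, Units.val_one, one_smul]

theorem mul_diagonalAut_mem_chevalleyInvolutions {τ : E ≃ₗ⁅ℂ⁆ E}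
    (hτ : τ ∈ A.chevalleyInvolutions) (ψ : A.characterGroup) :
    τ * A.diagonalAut ψ ∈ A.chevalleyInvolutions := by
  refine ⟨?_, fun h hh => ?_⟩
  · have h1 : (τ * A.diagonalAut ψ) ^ 2 = τ ^ 2 := by
      rw [pow_two, pow_two, mul_assoc, ← mul_assoc (A.diagonalAut ψ),
        diagonalAut_mul_mul_diagonalAut hτ.2]
    exact IsOfFinOrder.of_pow (h1 ▸ hτ.1.pow) two_ne_zero
  · rw [lieAut_mul_apply, A.diagonalAut_mem_cartanAut ψ h hh, hτ.2 h hh]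

end SplitQuadraticLieAlgebra

theorem theorem4p20 {E : Type*} [LieRing E] [LieAlgebra ℂ E] (A : ExtendedAffineLieAlgebra E)
    (hred : A.IsReduced) (hrank : 1 < A.rank) (hind : A.ind = 0) :
    (∃ Cfin : Subgroup (E ≃ₗ⁅ℂ⁆ E),
      (∀ Ψ : E ≃ₗ⁅ℂ⁆ E, Ψ ∈ Cfin ↔ Ψ ∈ A.cartanAut ∧ IsOfFinOrder Ψ) ∧
      ∃ e : Cfin ≃* CommGroup.torsion A.characterGroup,
        ∀ (Ψ : Cfin) (α : A.roots), ∀ x ∈ A.rootSpace α,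
          (Ψ : E ≃ₗ⁅ℂ⁆ E) x =
            (((e Ψ : A.characterGroup) : A.roots → ℂˣ) α : ℂ) • x) ∧
    (∀ τ ∈ A.chevalleyInvolutions, ∀ Ψ ∈ A.cartanAut, IsOfFinOrder Ψ →
      τ * Ψ ∈ A.chevalleyInvolutions) := by
  -- Taking the image of the torsion characters makes the subgroup property automatic; what remains
  -- is that this image exhausts the Cartan automorphisms of finite order.
  refine ⟨⟨(CommGroup.torsion A.characterGroup).map A.diagonalAut, fun Ψ => ?_,
    ((CommGroup.torsion A.characterGroup).equivMapOfInjective A.diagonalAut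
      SplitQuadraticLieAlgebra.diagonalAut_injective).symm, fun Ψ α x hx => ?_⟩, fun τ hτ Ψ hΨ hfin => ?_⟩
  · constructor
    · rintro ⟨ψ, hψ, rfl⟩
      exact ⟨A.diagonalAut_mem_cartanAut ψ, MonoidHom.isOfFinOrder _ hψ⟩
    · rintro ⟨hΨ, hfin⟩
      obtain ⟨ψ, rfl⟩ := ExtendedAffineLieAlgebra.exists_diagonalAut_eq hrank hind hΨ hfin
      exact ⟨ψ, SplitQuadraticLieAlgebra.diagonalAut_injective.isOfFinOrder_iff.1 hfin, rfl⟩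
  · obtain ⟨ψ, rfl⟩ := ((CommGroup.torsion A.characterGroup).equivMapOfInjective A.diagonalAut
      SplitQuadraticLieAlgebra.diagonalAut_injective).surjective Ψ
    rw [MulEquiv.symm_apply_apply]
    exact SplitQuadraticLieAlgebra.diagonalAut_apply _ α hx
  · obtain ⟨ψ, rfl⟩ := ExtendedAffineLieAlgebra.exists_diagonalAut_eq hrank hind hΨ hfin
    exact SplitQuadraticLieAlgebra.mul_diagonalAut_mem_chevalleyInvolutions hτ ψ
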